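/- A sketch $\mathcal S=(S,L,C,\sigma)$ is a small category $S$ with a class $L$ of small limit diagrams, a class $C$ of small colimit diagrams, and a function $\sigma$ assigning a cone to each diagram in $L$ and a cocone to each diagram in $C$. It is geometric if every diagram in $L$ is finite; a geometric sketch is lex if $S$ has finite limits and every limiting cone over a finite diagram in $S$ is, up to isomorphism of cones, one of the specified cones. $\mathsf{Mod}(\mathcal S)$ is the full subcategory of $\mathbf{Set}^S$ on the functors sending the specified cones to limit cones and the specified cocones to colimit cocones. For a locally small category $X$, $\mathsf P(X)\subseteq\mathbf{Set}^X$ is the full subcategory of small copresheaves, i.e. small colimits of corepresentable functors. A generalized ionad over $X$ is a comonad on $\mathsf P(X)$ preserving finite limits (the interior operator), where $X$ is required to be locally small and pre-finitely cocomplete (every finite diagram in $X$ has a small set of cocones such that each cocone factors through one of them). **Proposition.** Let $\mathcal S$ be a lex geometric sketch. For every $s\in S$ the functor $\mathsf{ev}(s)\colon\mathsf{Mod}(\mathcal S)\to\mathbf{Set}$, $M\mapsto M(s)$, is small, so that evaluation is a functor $\mathsf{ev}\colon S\to\mathsf P(\mathsf{Mod}(\mathcal S))$; the category $\mathsf P(\mathsf{Mod}(\mathcal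 S))$ has finite limits and $\mathsf{ev}$ preserves finite limits. Let $y\colon S\to\mathbf{Set}^{S^{\mathrm{op}}}$ be the Yoneda embedding. The pointwise left Kan extension $\mathrm{Lan}_y\mathsf{ev}\colon\mathbf{Set}^{S^{\mathrm{op}}}\to\mathsf P(\mathsf{Mod}(\mathcal S))$ exists, preserves finite limits, and has a right adjoint, which is the pointwise left Kan extension $\mathrm{Lan}_{\mathsf{ev}}y$ with unit $y\to(\mathrm{Lan}_{\mathsf{ev}}y)\,\mathsf{ev}$ the transpose of the canonical isomorphism $(\mathrm{Lan}_y\mathsf{ev})\,y\cong\mathsf{ev}$. The category $\mathsf{Mod}(\mathcal S)$ is pre-finitely cocomplete, and the comonad $$\mathrm{Int}_{\mathcal S}=\mathrm{Lan}_y\mathsf{ev}\circ\mathrm{Lan}_{\mathsf{ev}}y$$ induced by this adjunction preserves finite limits; hence it is the interior operator of a generalized ionad $\mathbb M\mathrm{od}(\mathcal S)$ over $\mathsf{Mod}(\mathcal S)$. Moreover $\mathrm{Int}_{\mathcal S}$ is the density comonad of $\mathsf{ev}$: for some $\theta\colon\mathsf{ev}\to\mathrm{Int}_{\mathcal S}\,\mathsf{ev}$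 it is the pointwise left Kan extension of $\mathsf{ev}$ along $\mathsf{ev}$ with unit $\theta$, and its counit $\varepsilon$ and comultiplication $\delta$ are determined by $\varepsilon_{\mathsf{ev}(s)}\circ\theta_s=1$ and $\delta_{\mathsf{ev}(s)}\circ\theta_s=\mathrm{Int}_{\mathcal S}(\theta_s)\circ\theta_s$ for all $s\in S$. -/

import Mathlib

open CategoryTheory CategoryTheory.Limits Opposite

universe w v u

/-- A sketch `(S, L, C, σ)`: a small category `S` with a class `L` of (small) limit diagrams and a
class `C` of (small) colimit diagrams, and a function `σ` assigning to each diagram in `L` a cone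
and to each diagram in `C` a cocone. -/
structure Sketch where
  /-- the underlying small category -/
  S : Type w
  [category : SmallCategory S]
  /-- the class of limit diagrams -/
  L : ∀ {J : Type w} [SmallCategory J], (J ⥤ S) → Prop
  /-- the class of colimit diagrams -/
  C : ∀ {J : Type w} [SmallCategory J], (J ⥤ S) → Prop
  /-- the specified cone of a limit diagram -/
  cone : ∀ {J : Type w} [SmallCategory J] (D : J ⥤ S), L D → Cone D
  /-- the specified cocone of a colimit diagram -/
  cocone : ∀ {J : Type w} [SmallCategory J] (D : J ⥤ S), C D → Cocone D

namespace Sketch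

attribute [instance] Sketch.category

/-- A sketch is geometric if each specified cone is finite. -/
def IsGeometric (𝒮 : Sketch.{w}) : Prop :=
  ∀ (J : Type w) [SmallCategory J] (D : J ⥤ 𝒮.S), 𝒮.L D → Nonempty (FinCategory J)

/-- A geometric sketch is lex if its underlying category has finite limits and every (finite)
limiting cone is in the limit class. As the sketch specifies a single cone for each diagram while
limiting cones are only unique up to isomorphism, the latter is meant up to isomorphism of cones. -/
structure IsLex (𝒮 : Sketch.{w}) : Prop where
  hasFiniteLimits : HasFiniteLimits 𝒮.S
  limiting_mem : ∀ (J : Type w) [SmallCategory J] [FinCategory J] (D : J ⥤ 𝒮.S) (c : Cone D),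
    IsLimit c → ∃ h : 𝒮.L D, Nonempty (𝒮.cone D h ≅ c)

/-- A (set-valued) model of a sketch: a functor `M : S ⥤ Set` mapping each specified cone to a limit
cone and each specified cocone to a colimit cocone. -/
structure IsModel (𝒮 : Sketch.{w}) (M : 𝒮.S ⥤ Type w) : Prop where
  isLimit : ∀ (J : Type w) [SmallCategory J] (D : J ⥤ 𝒮.S) (h : 𝒮.L D),
    Nonempty (IsLimit (M.mapCone (𝒮.cone D h)))
  isColimit : ∀ (J : Type w) [SmallCategory J] (D : J ⥤ 𝒮.S) (h : 𝒮.C D),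
    Nonempty (IsColimit (M.mapCocone (𝒮.cocone D h)))

/-- Being a model, as a property of objects of `S ⥤ Set`. -/
def modelProperty (𝒮 : Sketch.{w}) : ObjectProperty (𝒮.S ⥤ Type w) := fun M => 𝒮.IsModel M

/-- The category `Mod(𝒮)` of models: a full subcategory of `S ⥤ Set`. -/
abbrev Mod (𝒮 : Sketch.{w}) : Type (w + 1) := 𝒮.modelProperty.FullSubcategory

/-- The evaluation `S ⥤ (Mod(𝒮) ⥤ Set)`, `s ↦ (M ↦ M s)`. -/
def evaluation (𝒮 : Sketch.{w}) : 𝒮.S ⥤ 𝒮.Mod ⥤ Type w := 𝒮.modelProperty.ι.flip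

end Sketch

/-- A copresheaf on a locally small (possibly large) category is small if it is the colimit of a
small diagram of corepresentable functors. -/
def IsSmallCopresheaf {X : Type u} [Category.{v} X] : ObjectProperty (X ⥤ Type v) := fun P =>
  ∃ (J : Type v) (_ : SmallCategory J) (D : J ⥤ Xᵒᵖ)
    (ι : D ⋙ coyoneda ⟶ (Functor.const J).obj P), Nonempty (IsColimit (Cocone.mk P ι))

/-- The category `P(X)` of small copresheaves on `X`. -/
abbrev SmallCopresheaf (X : Type u) [Category.{v} X] : Type (max u (v + 1)) :=
  (IsSmallCopresheaf (X := X)).FullSubcategory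

/-- A category is pre-finitely cocomplete if each finite diagram `D` has a small set of cocones such
that every cocone under `D` factors through a member of that set. -/
def PreFinitelyCocomplete (X : Type u) [Category.{v} X] : Prop :=
  ∀ (J : Type) [SmallCategory J] [FinCategory J] (D : J ⥤ X),
    ∃ (ι : Type v) (c : ι → Cocone D), ∀ c' : Cocone D, ∃ i, Nonempty (c i ⟶ c')

/-- A (generalized) ionad over a locally small, possibly large category `X`: `X` is pre-finitely
cocomplete, and there is given a comonad on `P(X)` (the interior operator) that preserves finite
limits. -/
structure GeneralizedIonad (X : Type u) [Category.{v} X] where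
  preFinitelyCocomplete : PreFinitelyCocomplete X
  /-- the interior operator -/
  interior : Comonad (SmallCopresheaf X)
  interior_lex : PreservesFiniteLimits interior.toFunctor

/-- `G'`, with `α : F ⟶ L ⋙ G'`, is the (pointwise) left Kan extension of `F` along `L`. -/
def IsPointwiseLan {A B E : Type*} [Category* A] [Category* B] [Category* E]
    {L : A ⥤ B} {F : A ⥤ E} (G' : B ⥤ E) (α : F ⟶ L ⋙ G') : Prop :=
  Nonempty (Functor.LeftExtension.mk G' α).IsPointwiseLeftKanExtension

/-- The comonad `G`, with `θ : F ⟶ F ⋙ G`, is the density comonad of `F`: its underlying functor is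
the left Kan extension of `F` along `F` with unit `θ`, and its counit and comultiplication are the
(unique) transformations compatible with `θ` that the universal property provides. -/
structure IsDensityComonad {A B : Type*} [Category* A] [Category* B]
    (F : A ⥤ B) (G : Comonad B) (θ : F ⟶ F ⋙ G.toFunctor) : Prop where
  isLan : IsPointwiseLan G.toFunctor θ
  counit : ∀ a : A, θ.app a ≫ G.ε.app (F.obj a) = 𝟙 (F.obj a)
  comul : ∀ a : A, θ.app a ≫ G.δ.app (F.obj a) = θ.app a ≫ G.map (θ.app a)

/-- The evaluation functor `ev : S ⥤ P(Mod(𝒮))`, given that its values are small copresheaves. -/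
def Sketch.ev (𝒮 : Sketch.{w}) (h : ∀ s, IsSmallCopresheaf (𝒮.evaluation.obj s)) :
    𝒮.S ⥤ SmallCopresheaf 𝒮.Mod :=
  IsSmallCopresheaf.lift 𝒮.evaluation h

/-!
# The ionad of models of a lex geometric sketch

Let `𝒮` be a lex geometric sketch with category `S`. Its models are functors `S ⥤ Type w` that
preserve finite limits, and everything rests on the fact that each model is, in a bounded way, made
of small submodels.

*Small submodels.* A subfunctor `N` of a model `M` is pure if finite systems of equations in one
unknown with parameters in `N` that are solvable in `M` are solvable in `N`. Pure subfunctors of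
models are models. For limit cones this holds since they are finite, so that their elements are
unique solutions of finite systems. For colimit cocones, an equality in a colimit of sets is
witnessed by a finite zigzag, and since `S` has and `M` preserves finite limits, the zigzags of a
given shape in `M` are the elements of `M` at a single object of `S` (`exists_span_of_eqvGen`).
Closing under Skolem functions shows that each subset of `M` of cardinality at most `κ` lies in a
pure subfunctor of cardinality at most `κ`, for `κ` infinite and at least the number of arrows of
`S` (`exists_isPure_of_mk_le`).

*Small copresheaves.* Consequently each small family of models is part of a class with an absorbing
small family `N`: finite families of morphisms from that class to a model `M` factor through a
monomorphism `N i ⟶ M`. The monomorphisms `N i ⟶ M` form a small filtered category. A copresheaf `P`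
is determined by `N` if `P M` is the colimit of the sets `P (N i)` over this category, for all `M`.
Determined copresheaves are small, and each small copresheaf is determined by all sufficiently large
absorbing families. As filtered colimits commute with finite limits and with colimits, determined
copresheaves are closed under both, hence so are small copresheaves. The copresheaf `M ↦ M s` is
determined, hence small. Cocones under a finite diagram factor through cocones with apex in an
absorbing family, which makes the category of models pre-finitely cocomplete.

*The adjunction.* Since `P(Mod 𝒮)` is cocomplete and locally small, `ev` extends along the Yoneda
embedding to a left adjoint `L`, which is a pointwise left Kan extension by the density theorem.
At a model `M`, it is the colimit-preserving extension of `M : S ⥤ Type w`, which preserves finite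
limits because the category of elements of `M` is cofiltered
(`preservesFiniteLimits_of_preservesColimits`). The arrows `ev s ⟶ P` correspond to the arrows
`yoneda s ⟶ R P`, so that the density theorem also exhibits the right adjoint `R` as a pointwise
left Kan extension, which `L` preserves. The equations of the density comonad follow from the
triangle identities.
-/

/-! ### Pure subfunctors -/

open Cardinal in
/-- A sum of at most `κ` types of cardinality at most `κ` has cardinality at most `κ`. -/
lemma Cardinal.mk_sigma_le_of_le {ι : Type u} {f : ι → Type u} {κ : Cardinal.{u}} (hκ : ℵ₀ ≤ κ)
    (hι : #ι ≤ κ) (hf : ∀ i, #(f i) ≤ κ) : #(Σ i, f i) ≤ κ := by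
  rw [mk_sigma]
  refine (sum_le_sum _ (fun _ => κ) hf).trans ?_
  rw [sum_const']
  exact (mul_le_mul' hι le_rfl).trans (mul_eq_self hκ).le

/-- A subfunctor `N` of `M : C ⥤ Type w` is pure if each finite system of equations
`M.map (f i) x = y i` in one unknown `x`, with parameters `y i` in `N`, that has a solution in `M`
has a solution in `N`. -/
def CategoryTheory.Subfunctor.IsPure {C : Type u} [Category.{v} C] {M : C ⥤ Type w}
    (N : Subfunctor M) : Prop :=
  ∀ ⦃a : C⦄ ⦃n : ℕ⦄ (b : Fin n → C) (f : ∀ i, a ⟶ b i) (x : M.obj a),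
    (∀ i, M.map (f i) x ∈ N.obj (b i)) → ∃ x' ∈ N.obj a, ∀ i, M.map (f i) x' = M.map (f i) x

section Skolem

variable {S : Type w} [SmallCategory S]

/-- The language whose function symbols of arity `n` are the families of `n + 1` arrows of `S` with
common source. -/
def skolemLanguage (S : Type w) [SmallCategory S] : FirstOrder.Language.{w, 0} where
  Functions n := Σ a : S, (Σ c, a ⟶ c) × (Fin n → Σ b, a ⟶ b)
  Relations _ := Empty

open scoped Classical in
/-- The symbol given by arrows `g` and `f i` with source `a` acts on the elements of `M` by sending
a family `y` to `M.map g x` for a chosen solution `x` of the equations `M.map (f i) x = y i`. The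
value `none` stands for the absence of a solution. -/
noncomputable instance skolemStructure (M : S ⥤ Type w) :
    (skolemLanguage S).Structure (Option (Σ s, M.obj s)) where
  funMap {_} p y :=
    if h : ∃ x : M.obj p.1, ∀ i, y i = some ⟨(p.2.2 i).1, M.map (p.2.2 i).2 x⟩ then
      some ⟨p.2.1.1, M.map p.2.1.2 h.choose⟩
    else none
  RelMap r := r.elim

lemma exists_funMap_skolem {M : S ⥤ Type w} {a c : S} (g : a ⟶ c) {n : ℕ} (b : Fin n → S)
    (f : ∀ i, a ⟶ b i) (x : M.obj a) :
    ∃ x' : M.obj a, (∀ i, M.map (f i) x' = M.map (f i) x) ∧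
      FirstOrder.Language.Structure.funMap (L := skolemLanguage S)
        (M := Option (Σ s, M.obj s)) (n := n) ⟨a, ⟨c, g⟩, fun i => ⟨b i, f i⟩⟩
        (fun i => some ⟨b i, M.map (f i) x⟩) = some ⟨c, M.map g x'⟩ := by
  have h : ∃ x' : M.obj a, ∀ i, (some ⟨b i, M.map (f i) x⟩ : Option (Σ s, M.obj s)) =
      some ⟨b i, M.map (f i) x'⟩ := ⟨x, fun _ => rfl⟩
  refine ⟨h.choose, fun i => ?_, dif_pos h⟩
  simpa only [Option.some.injEq, Sigma.mk.injEq, heq_eq_eq, true_and, eq_comm]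
    using h.choose_spec i

open Cardinal in
lemma mk_le_of_mk_arrows_le {κ : Cardinal.{w}} (hS : #(Σ a b : S, a ⟶ b) ≤ κ) : #S ≤ κ :=
  (mk_le_of_injective (f := fun a : S => (⟨a, a, 𝟙 a⟩ : Σ a b : S, a ⟶ b))
    fun _ _ h => congrArg Sigma.fst h).trans hS

open Cardinal in
lemma mk_skolemLanguage_functions_le {κ : Cardinal.{w}} (hκ : ℵ₀ ≤ κ)
    (hS : #(Σ a b : S, a ⟶ b) ≤ κ) :
    Cardinal.lift.{w} #(Σ n, (skolemLanguage S).Functions n) ≤ κ := by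
  have hob : #S ≤ κ := mk_le_of_mk_arrows_le hS
  have harr (a : S) : #(Σ b, a ⟶ b) ≤ κ :=
    (mk_le_of_injective (f := fun g : Σ b, a ⟶ b => (⟨a, g⟩ : Σ a b : S, a ⟶ b))
      fun _ _ h => by simpa using h).trans hS
  rw [lift_id, mk_sigma]
  refine (sum_le_sum _ (fun _ => κ) fun n => mk_sigma_le_of_le hκ hob fun a => ?_).trans
    (by simpa using (mul_le_mul' hκ le_rfl).trans (mul_eq_self hκ).le)
  rw [← mul_def]
  refine (mul_le_mul' (harr a) ?_).trans (mul_eq_self hκ).le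
  rw [mk_arrow]
  simpa using (power_le_power_right (harr a)).trans (power_nat_le hκ)

open Cardinal in
/-- A downward Löwenheim–Skolem theorem for pure subfunctors: the closure of `T` under the Skolem
functions is a pure subfunctor. -/
theorem exists_isPure_of_mk_le (M : S ⥤ Type w) {κ : Cardinal.{w}} (hκ : ℵ₀ ≤ κ)
    (hS : #(Σ a b : S, a ⟶ b) ≤ κ) (T : ∀ s, Set (M.obj s)) (hT : ∀ s, #(T s) ≤ κ) :
    ∃ N : Subfunctor M, N.IsPure ∧ (∀ s, T s ⊆ N.obj s) ∧ ∀ s, #(N.obj s) ≤ κ := by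
  have hob : #S ≤ κ := mk_le_of_mk_arrows_le hS
  let gen : (Σ s, T s) → Option (Σ s, M.obj s) := fun p => some ⟨p.1, p.2.1⟩
  let K := FirstOrder.Language.Substructure.closure (skolemLanguage S) (Set.range gen)
  have hK : #K ≤ κ := by
    have h := FirstOrder.Language.Substructure.lift_card_closure_le (L := skolemLanguage S)
      (s := Set.range gen)
    have hgen : #(Set.range gen) ≤ κ := mk_range_le.trans (mk_sigma_le_of_le hκ hob hT)
    rw [lift_id, lift_id] at h
    exact h.trans (max_le hκ ((add_le_add hgen (mk_skolemLanguage_functions_le hκ hS)).trans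
      (add_eq_self hκ).le))
  have hmem {a c : S} (g : a ⟶ c) {n : ℕ} (b : Fin n → S) (f : ∀ i, a ⟶ b i) (x : M.obj a)
      (hx : ∀ i, some ⟨b i, M.map (f i) x⟩ ∈ K) :
      ∃ x' : M.obj a, (∀ i, M.map (f i) x' = M.map (f i) x) ∧ some ⟨c, M.map g x'⟩ ∈ K := by
    obtain ⟨x', h, h'⟩ := exists_funMap_skolem g b f x
    exact ⟨x', h, h' ▸ K.fun_mem _ _ hx⟩
  refine ⟨⟨fun s => {x | some ⟨s, x⟩ ∈ K}, fun {s t} f x hx => ?_⟩, ?_, fun s x hx => ?_,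
    fun s => ?_⟩
  -- The trivial equation `M.map (𝟙 s) x' = x` has `x` as its only solution, so that closure under
  -- the Skolem functions contains closure under the maps of `M`.
  · obtain ⟨x', h, h'⟩ := hmem f (fun _ : Fin 1 => s) (fun _ => 𝟙 s) x (by simpa using hx)
    obtain rfl : x' = x := by simpa using h 0
    exact h'
  · intro a n b f x hx
    obtain ⟨x', h, h'⟩ := hmem (𝟙 a) b f x hx
    exact ⟨x', by simpa using h', h⟩
  · exact FirstOrder.Language.Substructure.subset_closure ⟨⟨s, x, hx⟩, rfl⟩
  · refine (mk_le_of_injective (α := {x : M.obj s | some (⟨s, x⟩ : Σ s, M.obj s) ∈ K})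
      (f := fun x => (⟨some (⟨s, x.1⟩ : Σ s, M.obj s), x.2⟩ : K)) fun x y h => ?_).trans hK
    simpa [Subtype.ext_iff] using h

end Skolem

/-! ### Pure subfunctors and limits and colimits -/

section Pure

variable {C : Type u} [Category.{v} C] {M : C ⥤ Type w}

/-- A zigzag witnessing that two elements become equal in the colimit of `D ⋙ M` involves finitely
many arrows. If `M` preserves pullbacks, it is therefore the image of an element of `M` at a single
object `a`, namely the limit of the zigzag of these arrows; the statement says that the span
`D.obj p.1 ⟵ a ⟶ D.obj q.1` identifies elements in the colimit of `D ⋙ N` for every `N`. -/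
lemma exists_span_of_eqvGen [HasPullbacks C] [PreservesLimitsOfShape WalkingCospan M]
    {J : Type*} [Category* J] (D : J ⥤ C) {p q : Σ j, (D ⋙ M).obj j}
    (h : Relation.EqvGen (D ⋙ M).ColimitTypeRel p q) :
    ∃ (a : C) (f : a ⟶ D.obj p.1) (g : a ⟶ D.obj q.1) (z : M.obj a),
      M.map f z = p.2 ∧ M.map g z = q.2 ∧
      ∀ (N : C ⥤ Type w) (t : N.obj a), (D ⋙ N).ιColimitType p.1 (N.map f t) =
        (D ⋙ N).ιColimitType q.1 (N.map g t) := by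
  induction h with
  | rel p q h =>
    obtain ⟨k, hk⟩ := h
    refine ⟨D.obj p.1, 𝟙 _, D.map k, p.2, by simp, hk.symm, fun N t => ?_⟩
    rw [← (D ⋙ N).ιColimitType_map k]
    simp
  | refl p => exact ⟨D.obj p.1, 𝟙 _, 𝟙 _, p.2, by simp, by simp, fun N t => rfl⟩
  | symm p q _ ih =>
    obtain ⟨a, f, g, z, hf, hg, h⟩ := ih
    exact ⟨a, g, f, z, hg, hf, fun N t => (h N t).symm⟩
  | trans p q r _ _ ih ih' =>
    obtain ⟨a, f, g, z, hf, hg, h⟩ := ih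
    obtain ⟨a', f', g', z', hf', hg', h'⟩ := ih'
    have hz : M.map g z = M.map f' z' := hg.trans hf'.symm
    obtain ⟨y, hy, hy'⟩ :=
      Types.exists_of_isPullback ((IsPullback.of_hasPullback g f').map M) z z' hz
    refine ⟨pullback g f', pullback.fst _ _ ≫ f, pullback.snd _ _ ≫ g', y, ?_, ?_, fun N t => ?_⟩
    · simp [← hf, ← hy]
    · simp [← hg', ← hy']
    · have h₁ := h N (N.map (pullback.fst g f') t)
      have h₂ := h' N (N.map (pullback.snd g f') t)
      rw [← types_comp_apply (N.map (pullback.fst g f')), ← N.map_comp,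
        ← types_comp_apply (N.map (pullback.fst g f')), ← N.map_comp] at h₁
      rw [← types_comp_apply (N.map (pullback.snd g f')), ← N.map_comp,
        ← types_comp_apply (N.map (pullback.snd g f')), ← N.map_comp] at h₂
      rw [h₁, pullback.condition, h₂]

namespace CategoryTheory.Subfunctor.IsPure

variable {N : Subfunctor M}

lemma exists_of_finite (hN : N.IsPure) {ι : Type*} [Finite ι] {a : C} (b : ι → C)
    (f : ∀ i, a ⟶ b i) (x : M.obj a) (hx : ∀ i, M.map (f i) x ∈ N.obj (b i)) :
    ∃ x' ∈ N.obj a, ∀ i, M.map (f i) x' = M.map (f i) x := by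
  obtain ⟨n, ⟨e⟩⟩ := Finite.exists_equiv_fin ι
  obtain ⟨x', hx'N, h⟩ := hN (fun i => b (e.symm i)) (fun i => f (e.symm i)) x fun i => hx _
  exact ⟨x', hx'N, e.symm.surjective.forall.2 h⟩

/-- Uniqueness of the solution turns purity into closure under finite limits. -/
lemma nonempty_isLimit_mapCone (hN : N.IsPure) {J : Type*} [Category* J] [Finite J] {D : J ⥤ C}
    {c : Cone D} (hc : Nonempty (IsLimit (M.mapCone c))) :
    Nonempty (IsLimit (N.toFunctor.mapCone c)) := by
  rw [Types.isLimit_iff] at hc ⊢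
  intro s hs
  obtain ⟨x, hx, hx'⟩ := hc (fun j => (s j).1) fun f => congrArg Subtype.val (hs f)
  have hπ (j) : M.map (c.π.app j) x = (s j).1 := hx j
  obtain ⟨x', hx'N, h⟩ := hN.exists_of_finite D.obj c.π.app x fun j => by
    rw [hπ]; exact (s j).2
  obtain rfl : x' = x := hx' x' fun j => (h j).trans (hπ j)
  exact ⟨⟨x', hx'N⟩, fun j => Subtype.ext (hπ j),
    fun y hy => Subtype.ext (hx' y.1 fun j => congrArg Subtype.val (hy j))⟩

lemma nonempty_isColimit_mapCocone (hN : N.IsPure) [HasPullbacks C]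
    [PreservesLimitsOfShape WalkingCospan M] {J : Type*} [Category* J] {D : J ⥤ C} {c : Cocone D}
    (hc : Nonempty (IsColimit (M.mapCocone c))) :
    Nonempty (IsColimit (N.toFunctor.mapCocone c)) := by
  rw [Types.isColimit_iff_coconeTypesIsColimit] at hc ⊢
  refine ⟨fun u₁ u₂ hu => ?_, fun x => ?_⟩
  · obtain ⟨j₁, x₁, rfl⟩ := Functor.ιColimitType_jointly_surjective _ u₁
    obtain ⟨j₂, x₂, rfl⟩ := Functor.ιColimitType_jointly_surjective _ u₂
    have h : (D ⋙ M).ιColimitType j₁ x₁.1 = (D ⋙ M).ιColimitType j₂ x₂.1 :=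
      hc.bijective.1 (congrArg Subtype.val hu)
    obtain ⟨a, f, g, z, hf, hg, h⟩ :=
      exists_span_of_eqvGen D ((Functor.ιColimitType_eq_iff _ _ _).1 h)
    -- Only the element `z` of the span has to be moved into `N`.
    obtain ⟨z', hz', h'⟩ := hN.exists_of_finite (ι := Bool) (fun i => D.obj (bif i then j₁ else j₂))
      (fun i => match i with | true => f | false => g) z
      fun i => match i with | true => hf ▸ x₁.2 | false => hg ▸ x₂.2
    have h₁ : x₁ = N.toFunctor.map f ⟨z', hz'⟩ := Subtype.ext (hf.symm.trans (h' true).symm)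
    have h₂ : x₂ = N.toFunctor.map g ⟨z', hz'⟩ := Subtype.ext (hg.symm.trans (h' false).symm)
    rw [h₁, h₂]
    exact h N.toFunctor ⟨z', hz'⟩
  · obtain ⟨u, hu⟩ := hc.bijective.2 x.1
    obtain ⟨j, y, rfl⟩ := Functor.ιColimitType_jointly_surjective _ u
    have hy : M.map (c.ι.app j) y = x.1 := hu
    obtain ⟨y', hy', h⟩ := hN.exists_of_finite (ι := Unit) (fun _ => c.pt) (fun _ => c.ι.app j) y
      fun _ => hy ▸ x.2
    exact ⟨(D ⋙ N.toFunctor).ιColimitType j ⟨y', hy'⟩, Subtype.ext ((h ()).trans hy)⟩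

end CategoryTheory.Subfunctor.IsPure

end Pure

/-! ### Absorbing families -/

section Absorbing

variable {X : Type u} [Category.{v} X]

/-- A small family `N` of objects is absorbing for the class `Q`, which contains it, if each finite
family of morphisms `B a ⟶ M` with `B a` in `Q` factors through a monomorphism `N i ⟶ M`. -/
structure IsAbsorbing {I : Type v} (N : I → X) (Q : ObjectProperty X) : Prop where
  mem (i : I) : Q (N i)
  exists_mono (M : X) {F : Type} [Finite F] (B : F → X) (hB : ∀ a, Q (B a)) (f : ∀ a, B a ⟶ M) :
    ∃ (i : I) (h : N i ⟶ M), Mono h ∧ ∀ a, ∃ g : B a ⟶ N i, g ≫ h = f a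

variable (X) in
/-- Each small family of objects is contained in a class that has an absorbing small family. -/
def HasAbsorbingFamilies : Prop :=
  ∀ (K : Type v) (A : K → X), ∃ (I : Type v) (N : I → X) (Q : ObjectProperty X),
    IsAbsorbing N Q ∧ ∀ k, Q (A k)

/-- A cocone with apex `M` factors through a monomorphism `N i ⟶ M` that absorbs its legs: these
factors form a cocone since the monomorphism can be cancelled. -/
theorem HasAbsorbingFamilies.preFinitelyCocomplete (hX : HasAbsorbingFamilies X) :
    PreFinitelyCocomplete X := by
  intro J _ _ D
  obtain ⟨I, N, Q, hN, hD⟩ := hX (ULift J) fun j => D.obj j.down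
  refine ⟨Σ i, D ⟶ (Functor.const J).obj (N i), fun p => ⟨N p.1, p.2⟩, fun c => ?_⟩
  obtain ⟨i, h, _, hg⟩ := hN.exists_mono c.pt D.obj (fun j => hD ⟨j⟩) c.ι.app
  choose g hg using hg
  refine ⟨⟨i, { app := g, naturality := fun j j' f => ?_ }⟩, ⟨{ hom := h, w := hg }⟩⟩
  simp [← cancel_mono h, hg]

variable {I : Type v} (N : I → X)

/-- A monomorphism to `M` from a member of the family `N`. -/
structure MonosTo (M : X) : Type v where
  /-- the index of the source -/
  index : I
  /-- the monomorphism -/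
  hom : N index ⟶ M
  mono : Mono hom

/-- The small category of monomorphisms to `M` from members of the family `N`, a full subcategory of
the slice over `M`. -/
instance (M : X) : SmallCategory (MonosTo N M) where
  Hom A B := {g : N A.index ⟶ N B.index // g ≫ B.hom = A.hom}
  id A := ⟨𝟙 _, Category.id_comp _⟩
  comp f g := ⟨f.1 ≫ g.1, by rw [Category.assoc, g.2, f.2]⟩

variable {N}

lemma IsAbsorbing.isFiltered {Q : ObjectProperty X} (hN : IsAbsorbing N Q) (M : X) :
    IsFiltered (MonosTo N M) where
  nonempty := by
    obtain ⟨i, h, hh, -⟩ := hN.exists_mono M (F := Empty) (fun a => a.elim) (fun a => a.elim)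
      (fun a => a.elim)
    exact ⟨⟨i, h, hh⟩⟩
  cocone_objs A B := by
    obtain ⟨i, h, hh, hg⟩ := hN.exists_mono M (F := Bool)
      (fun b => N (bif b then A.index else B.index)) (fun b => hN.mem _)
      (fun b => match b with | true => A.hom | false => B.hom)
    obtain ⟨g, hg₁⟩ := hg true
    obtain ⟨g', hg₂⟩ := hg false
    exact ⟨⟨i, h, hh⟩, ⟨g, hg₁⟩, ⟨g', hg₂⟩, trivial⟩
  cocone_maps A B f g := by
    have := B.mono
    have h : f = g := Subtype.ext ((cancel_mono B.hom).1 (f.2.trans g.2.symm))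
    exact ⟨B, 𝟙 B, by rw [h]⟩

variable (N)

/-- The forgetful functor. -/
@[simps]
def MonosTo.source (M : X) : MonosTo N M ⥤ X where
  obj A := N A.index
  map f := f.1

/-- The tautological cocone on the forgetful functor. -/
@[simps]
def MonosTo.cocone (M : X) : Cocone (MonosTo.source N M) where
  pt := M
  ι := { app := fun A => A.hom, naturality := fun _ _ f => f.2.trans (Category.comp_id _).symm }

/-- A copresheaf is determined by the family `N` if its value at each `M` is the colimit of its
values at the members of `N` that are subobjects of `M`. -/
def IsDetermined (P : X ⥤ Type v) : Prop :=
  ∀ M, Nonempty (IsColimit (P.mapCocone (MonosTo.cocone N M)))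

/-- The comparison from the colimit of the values of a copresheaf at the members of `N` that are
subobjects of `M` to its value at `M`. -/
noncomputable def determinationMap (M : X) :
    (Functor.whiskeringLeft _ _ (Type v)).obj (MonosTo.source N M) ⋙ colim ⟶
      (evaluation X (Type v)).obj M where
  app P := colimit.desc _ (P.mapCocone (MonosTo.cocone N M))
  naturality P P' φ := colimit.hom_ext fun A => by
    refine (ι_colimMap_assoc _ _ _).trans ?_
    refine Eq.trans ?_ (colimit.ι_desc_assoc _ _ _).symm
    refine (congrArg _ (colimit.ι_desc _ _)).trans ?_
    exact (φ.naturality A.hom).symm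

variable {N}

lemma isDetermined_iff {P : X ⥤ Type v} :
    IsDetermined N P ↔ ∀ M, IsIso ((determinationMap N M).app P) :=
  forall_congr' fun _ => (colimit.isColimit _).nonempty_isColimit_iff_isIso_desc

/-- Both sides of `determinationMap` preserve colimits. -/
lemma IsDetermined.of_isColimit {J : Type v} [SmallCategory J] {D : J ⥤ X ⥤ Type v} {c : Cocone D}
    (hc : IsColimit c) (hD : ∀ j, IsDetermined N (D.obj j)) : IsDetermined N c.pt := by
  simp only [isDetermined_iff] at hD ⊢
  intro M
  have : IsIso (Functor.whiskerLeft D (determinationMap N M)) :=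
    (NatTrans.isIso_iff_isIso_app _).2 fun j => hD j M
  exact isIso_app_coconePt_of_preservesColimit D (determinationMap N M) c hc

/-- A natural transformation between functors preserving a limit is invertible at the limit if it
is so at the objects of the diagram. -/
lemma CategoryTheory.Limits.isIso_app_conePt_of_preservesLimit {C D J : Type*} [Category* C]
    [Category* D] [Category* J] (K : J ⥤ C) {L L' : C ⥤ D} (α : L ⟶ L')
    [IsIso (Functor.whiskerLeft K α)] (c : Cone K) (hc : IsLimit c)
    [PreservesLimit K L] [PreservesLimit K L'] : IsIso (α.app c.pt) := by
  let e := IsLimit.conePointsIsoOfNatIso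
    (isLimitOfPreserves L hc) (isLimitOfPreserves L' hc) (asIso (Functor.whiskerLeft K α))
  have h : e.hom = α.app c.pt := (isLimitOfPreserves L' hc).hom_ext fun j =>
    ((isLimitOfPreserves L hc).conePointsIsoOfNatIso_hom_comp _ _ j).trans (by simp)
  exact h ▸ inferInstance

/-- Both sides of `determinationMap` preserve finite limits: the left-hand side since the colimit
is filtered. -/
lemma IsDetermined.of_isLimit {Q : ObjectProperty X} (hN : IsAbsorbing N Q) {J : Type}
    [SmallCategory J] [FinCategory J] {D : J ⥤ X ⥤ Type v} {c : Cone D}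
    (hc : IsLimit c) (hD : ∀ j, IsDetermined N (D.obj j)) : IsDetermined N c.pt := by
  simp only [isDetermined_iff] at hD ⊢
  intro M
  have := hN.isFiltered M
  have : IsIso (Functor.whiskerLeft D (determinationMap N M)) :=
    (NatTrans.isIso_iff_isIso_app _).2 fun j => hD j M
  exact isIso_app_conePt_of_preservesLimit D (determinationMap N M) c hc

lemma IsAbsorbing.isDetermined_coyoneda {Q : ObjectProperty X} (hN : IsAbsorbing N Q) {A : X}
    (hA : Q A) : IsDetermined N (coyoneda.obj (op A)) := by
  intro M
  have := hN.isFiltered M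
  refine ⟨Types.FilteredColimit.isColimitOf' _ _ (fun (f : A ⟶ M) => ?_) fun B x y h => ?_⟩
  · obtain ⟨i, h, hh, hg⟩ := hN.exists_mono M (F := Unit) (fun _ => A) (fun _ => hA) (fun _ => f)
    obtain ⟨g, hg⟩ := hg ()
    exact ⟨⟨i, h, hh⟩, g, hg.symm⟩
  · have := B.mono
    exact ⟨B, 𝟙 B, congrArg _ ((cancel_mono B.hom).1 h)⟩

/-- An element of a copresheaf at a member of the family `N`. -/
structure FamilyElements (N : I → X) (P : X ⥤ Type v) : Type v where
  /-- the index of the member -/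
  index : I
  /-- the element -/
  elt : P.obj (N index)

/-- The small category of elements of `P` at members of the family `N`. -/
instance (P : X ⥤ Type v) : SmallCategory (FamilyElements N P) where
  Hom A B := {g : N A.index ⟶ N B.index // P.map g A.elt = B.elt}
  id A := ⟨𝟙 _, by simp⟩
  comp f g := ⟨f.1 ≫ g.1, by rw [P.map_comp, types_comp_apply, f.2, g.2]⟩

/-- The forgetful functor. -/
@[simps]
def FamilyElements.forget (N : I → X) (P : X ⥤ Type v) : FamilyElements N P ⥤ X where
  obj A := N A.index
  map f := f.1

/-- The presentation of a determined copresheaf as a colimit is the tautological one, indexed by its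
elements at the members of the family. -/
theorem IsDetermined.isSmallCopresheaf {Q : ObjectProperty X} (hN : IsAbsorbing N Q)
    {P : X ⥤ Type v} (hP : IsDetermined N P) : IsSmallCopresheaf P := by
  have hsurj : ∀ {M : X} (x : P.obj M), ∃ (i : I) (h : N i ⟶ M) (y : P.obj (N i)),
      P.map h y = x := fun {M} x => by
    obtain ⟨A, y, hy⟩ := Types.jointly_surjective_of_isColimit (hP M).some x
    exact ⟨A.index, A.hom, y, hy⟩
  have heq : ∀ {M : X} {i : I} (h : N i ⟶ M) [Mono h] (y y' : P.obj (N i)),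
      P.map h y = P.map h y' → ∃ (k : I) (g : N i ⟶ N k) (h' : N k ⟶ M), g ≫ h' = h ∧
        P.map g y = P.map g y' := fun {M i} h hh y y' hy => by
    have := hN.isFiltered M
    obtain ⟨B, g, hg⟩ := (Types.FilteredColimit.isColimit_eq_iff' (hP M).some
      (i := ⟨i, h, hh⟩) y y').1 hy
    exact ⟨B.index, g.1, B.hom, g.2, hg⟩
  let D : (FamilyElements N P)ᵒᵖ ⥤ Xᵒᵖ := (FamilyElements.forget N P).op
  let ι : D ⋙ coyoneda ⟶ (Functor.const _).obj P :=
    { app := fun e => coyonedaEquiv.symm e.unop.elt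
      naturality := fun e e' g => by
        ext M f
        change N e.unop.index ⟶ M at f
        change P.map (g.unop.1 ≫ f) e'.unop.elt = P.map f e.unop.elt
        rw [P.map_comp, types_comp_apply, g.unop.2] }
  have hs (s : Cocone (D ⋙ coyoneda)) {M : X} {i k : I} (g : N i ⟶ N k) (h : N k ⟶ M)
      (y : P.obj (N i)) : (s.ι.app (op ⟨k, P.map g y⟩)).app M h =
        (s.ι.app (op ⟨i, y⟩)).app M (g ≫ h) := by
    let φ : (⟨i, y⟩ : FamilyElements N P) ⟶ ⟨k, P.map g y⟩ := ⟨g, rfl⟩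
    exact (ConcreteCategory.congr_hom (NatTrans.congr_app (s.w φ.op) M) h).symm
  -- Two representations of the same element of `P.obj M` are compared in a common member of `N`.
  have hs' (s : Cocone (D ⋙ coyoneda)) {M : X} {i i' : I} (f : N i ⟶ M) (f' : N i' ⟶ M)
      (y : P.obj (N i)) (y' : P.obj (N i')) (h : P.map f y = P.map f' y') :
      (s.ι.app (op ⟨i, y⟩)).app M f = (s.ι.app (op ⟨i', y'⟩)).app M f' := by
    obtain ⟨k, m, _, hg⟩ := hN.exists_mono M (F := Bool) (fun b => N (bif b then i else i'))
      (fun b => hN.mem _) (fun b => match b with | true => f | false => f')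
    obtain ⟨g, rfl : g ≫ m = f⟩ := hg true
    obtain ⟨g', rfl : g' ≫ m = f'⟩ := hg false
    change N i ⟶ N k at g
    change N i' ⟶ N k at g'
    rw [P.map_comp, P.map_comp, types_comp_apply, types_comp_apply] at h
    obtain ⟨l, n, m', rfl, h'⟩ := heq m _ _ h
    refine (hs s g _ y).symm.trans (Eq.trans ?_ (hs s g' _ y'))
    refine (hs s n m' _).symm.trans (Eq.trans ?_ (hs s n m' (P.map g' y')))
    rw [h']
  choose i₀ f₀ y₀ h₀ using @hsurj
  have hdesc (s : Cocone (D ⋙ coyoneda)) {M : X} (x : P.obj M) {i : I} (f : N i ⟶ M)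
      (y : P.obj (N i)) (h : P.map f y = x) :
      (s.ι.app (op ⟨i₀ x, y₀ x⟩)).app M (f₀ x) = (s.ι.app (op ⟨i, y⟩)).app M f :=
    hs' s _ _ _ _ ((h₀ x).trans h.symm)
  refine ⟨(FamilyElements N P)ᵒᵖ, inferInstance, D, ι, ⟨?_⟩⟩
  exact
    { desc := fun s =>
        { app := fun M => ↾fun x => (s.ι.app (op ⟨i₀ x, y₀ x⟩)).app M (f₀ x)
          naturality := fun M M' g => by
            ext x
            refine (hdesc s (P.map g x) (f₀ x ≫ g) (y₀ x) ?_).trans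
              (NatTrans.naturality_apply (s.ι.app (op ⟨i₀ x, y₀ x⟩)) g (f₀ x))
            rw [P.map_comp, types_comp_apply, h₀] }
      fac := fun s e => by
        ext M f
        exact hdesc s _ f e.unop.elt rfl
      uniq := fun s m hm => by
        ext M x
        have h := ConcreteCategory.congr_hom (NatTrans.congr_app (hm (op ⟨i₀ x, y₀ x⟩)) M) (f₀ x)
        refine Eq.trans ?_ h
        exact congrArg (m.app M) (h₀ x).symm }

/-! ### Small copresheaves -/

/-- A small copresheaf is determined by any absorbing family for the objects of a presentation. -/
lemma IsSmallCopresheaf.exists_family {P : X ⥤ Type v} (hP : IsSmallCopresheaf P) :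
    ∃ (K : Type v) (A : K → X), ∀ {I : Type v} {N : I → X} {Q : ObjectProperty X},
      IsAbsorbing N Q → (∀ k, Q (A k)) → IsDetermined N P := by
  obtain ⟨J, _, D, ι, ⟨hι⟩⟩ := hP
  exact ⟨J, fun j => (D.obj j).unop, fun hN hA =>
    IsDetermined.of_isColimit hι fun j => hN.isDetermined_coyoneda (hA j)⟩

/-- Small families of small copresheaves are determined by a common absorbing family. -/
lemma HasAbsorbingFamilies.exists_isDetermined (hX : HasAbsorbingFamilies X) {J : Type v}
    (P : J → X ⥤ Type v) (hP : ∀ j, IsSmallCopresheaf (P j)) :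
    ∃ (I : Type v) (N : I → X) (Q : ObjectProperty X), IsAbsorbing N Q ∧
      ∀ j, IsDetermined N (P j) := by
  choose K A hA using fun j => (hP j).exists_family
  obtain ⟨I, N, Q, hN, hQ⟩ := hX (Σ j, K j) fun p => A p.1 p.2
  exact ⟨I, N, Q, hN, fun j => hA j hN fun k => hQ ⟨j, k⟩⟩

theorem HasAbsorbingFamilies.isClosedUnderColimitsOfShape (hX : HasAbsorbingFamilies X)
    (J : Type v) [SmallCategory J] :
    (IsSmallCopresheaf (X := X)).IsClosedUnderColimitsOfShape J where
  colimitsOfShape_le := by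
    rintro P ⟨h⟩
    obtain ⟨I, N, Q, hN, hP⟩ := hX.exists_isDetermined h.diag.obj h.prop_diag_obj
    exact (IsDetermined.of_isColimit h.isColimit hP).isSmallCopresheaf hN

theorem HasAbsorbingFamilies.isClosedUnderLimitsOfShape (hX : HasAbsorbingFamilies X)
    (J : Type) [SmallCategory J] [FinCategory J] :
    (IsSmallCopresheaf (X := X)).IsClosedUnderLimitsOfShape J where
  limitsOfShape_le := by
    rintro P ⟨h⟩
    obtain ⟨I, N, Q, hN, hP⟩ := hX.exists_isDetermined (fun j : ULift J => h.diag.obj j.down)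
      fun j => h.prop_diag_obj j.down
    exact (IsDetermined.of_isLimit hN h.isLimit fun j => hP ⟨j⟩).isSmallCopresheaf hN

/-- By the Yoneda lemma, a morphism from a small colimit of corepresentable functors to `P'` is
given by a small family of elements of `P'`. -/
instance : LocallySmall.{v} (SmallCopresheaf X) where
  hom_small P P' := by
    obtain ⟨J, _, D, ι, ⟨hι⟩⟩ := P.property
    refine small_of_injective (β := ∀ j, P'.obj.obj (D.obj j).unop)
      (f := fun φ j => coyonedaEquiv (ι.app j ≫ φ.hom)) fun φ ψ h => ?_
    ext : 1
    exact hι.hom_ext fun j => coyonedaEquiv.injective (congrFun h j)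

end Absorbing

/-! ### Models of lex geometric sketches -/

lemma CategoryTheory.NatTrans.exists_factor_of_injective {C : Type u} [Category.{v} C]
    {F G H : C ⥤ Type w} (h : G ⟶ H) (hh : ∀ s, Function.Injective (h.app s)) (f : F ⟶ H)
    (hf : ∀ s, Set.range (f.app s) ⊆ Set.range (h.app s)) : ∃ g : F ⟶ G, g ≫ h = f := by
  choose g hg using fun s x => hf s ⟨x, rfl⟩
  refine ⟨{ app := fun s => ↾(g s), naturality := fun s t k => ?_ }, ?_⟩
  · ext x
    refine hh t ?_
    refine (hg t _).trans (Eq.trans ?_ (NatTrans.naturality_apply h k (g s x)).symm)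
    rw [hg]
    exact NatTrans.naturality_apply f k x
  · ext s x
    exact hg s x

namespace Sketch

variable {𝒮 : Sketch.{w}}

lemma IsModel.of_iso {M M' : 𝒮.S ⥤ Type w} (hM : 𝒮.IsModel M) (e : M ≅ M') : 𝒮.IsModel M' where
  isLimit J _ D h := (hM.isLimit J D h).map (IsLimit.mapConeEquiv e)
  isColimit J _ D h := (hM.isColimit J D h).map (IsColimit.mapCoconeEquiv e)

lemma IsModel.preservesFiniteLimits (hlex : 𝒮.IsLex) {M : 𝒮.S ⥤ Type w} (hM : 𝒮.IsModel M) :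
    PreservesFiniteLimits M := by
  refine preservesFiniteLimits_of_preservesFiniteLimitsOfSize.{w} M fun J _ _ => ⟨fun {D} => ⟨?_⟩⟩
  intro c hc
  obtain ⟨h, ⟨e⟩⟩ := hlex.limiting_mem J D c hc
  exact (hM.isLimit J D h).map fun hl => hl.ofIsoLimit ((Cone.functoriality D M).mapIso e)

/-- The finiteness of the limit diagrams is what makes purity sufficient. -/
lemma IsModel.of_isPure (hgeo : 𝒮.IsGeometric) (hlex : 𝒮.IsLex) {M : 𝒮.S ⥤ Type w}
    (hM : 𝒮.IsModel M) {N : Subfunctor M} (hN : N.IsPure) : 𝒮.IsModel N.toFunctor where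
  isLimit J _ D h := by
    obtain ⟨_⟩ := hgeo J D h
    exact hN.nonempty_isLimit_mapCone (hM.isLimit J D h)
  isColimit J _ D h := by
    have := hM.preservesFiniteLimits hlex
    have := hlex.hasFiniteLimits
    exact hN.nonempty_isColimit_mapCocone (hM.isColimit J D h)

lemma mono_of_injective {M M' : 𝒮.Mod} {h : M ⟶ M'} (hh : ∀ s, Function.Injective (h.hom.app s)) :
    Mono h := by
  refine ⟨fun f g hfg => ?_⟩
  ext s x
  exact hh s (ConcreteCategory.congr_hom (NatTrans.congr_app (congrArg (fun k => k.hom) hfg) s) x)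

/-- The models whose values are subsets of `U`: these form a set, as opposed to a class. -/
def SubsetModel (𝒮 : Sketch.{w}) (U : Type w) : Type w :=
  { F : 𝒮.S ⥤ InducedCategory (Type w) (fun A : Set U => (A : Type w)) //
    𝒮.IsModel (F ⋙ inducedFunctor _) }

/-- The underlying model. -/
def SubsetModel.toMod {U : Type w} (N : 𝒮.SubsetModel U) : 𝒮.Mod := ⟨N.1 ⋙ inducedFunctor _, N.2⟩

/-- The models whose values have at most the cardinality of `U`. -/
def boundedModels (𝒮 : Sketch.{w}) (U : Type w) : ObjectProperty 𝒮.Mod := fun M =>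
  ∀ s, Cardinal.mk (M.obj.obj s) ≤ Cardinal.mk U

lemma SubsetModel.boundedModels {U : Type w} (N : 𝒮.SubsetModel U) :
    𝒮.boundedModels U N.toMod := fun s => Cardinal.mk_set_le (N.1.obj s : Set U)

lemma exists_subsetModel_iso {U : Type w} {M : 𝒮.Mod} (hM : 𝒮.boundedModels U M) :
    ∃ N : 𝒮.SubsetModel U, Nonempty (N.toMod ≅ M) := by
  have e (s) : Nonempty (M.obj.obj s ↪ U) := (Cardinal.le_def _ _).1 (hM s)
  let e' (s) : M.obj.obj s ↪ U := (e s).some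
  let G : 𝒮.S ⥤ Type w := M.obj.copyObj (fun s => Set.range (e' s)) fun s =>
    (Equiv.ofInjective _ (e' s).injective).toIso
  let F : 𝒮.S ⥤ InducedCategory (Type w) (fun A : Set U => (A : Type w)) :=
    { obj := fun s => Set.range (e' s)
      map := fun f => InducedCategory.homMk (G.map f)
      map_id := fun s => InducedCategory.hom_ext (G.map_id s)
      map_comp := fun f g => InducedCategory.hom_ext (G.map_comp f g) }
  have i : M.obj ≅ F ⋙ inducedFunctor _ := M.obj.isoCopyObj _ _
  exact ⟨⟨F, M.property.of_iso i⟩, ⟨(ObjectProperty.isoMk _ i).symm⟩⟩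

/-- The cardinality of `U` is infinite and bounds the number of arrows of the sketch, so that the
downward Löwenheim–Skolem theorem applies. -/
structure IsLarge (𝒮 : Sketch.{w}) (U : Type w) : Prop where
  infinite : Infinite U
  mk_arrows_le : Cardinal.mk (Σ a b : 𝒮.S, a ⟶ b) ≤ Cardinal.mk U

section

variable {U : Type w}

lemma exists_subsetModel_range (hgeo : 𝒮.IsGeometric) (hlex : 𝒮.IsLex) (hU : 𝒮.IsLarge U)
    (M : 𝒮.Mod) (T : ∀ s, Set (M.obj.obj s))
    (hT : ∀ s, Cardinal.mk (T s) ≤ Cardinal.mk U) :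
    ∃ (N : 𝒮.SubsetModel U) (h : N.toMod ⟶ M), (∀ s, Function.Injective (h.hom.app s)) ∧
      ∀ s, T s ⊆ Set.range (h.hom.app s) := by
  have := hU.infinite
  obtain ⟨N, hN, hTN, hNU⟩ := exists_isPure_of_mk_le M.obj (Cardinal.aleph0_le_mk U)
    hU.mk_arrows_le T hT
  obtain ⟨N', ⟨e⟩⟩ := exists_subsetModel_iso (U := U)
    (M := ⟨N.toFunctor, M.property.of_isPure hgeo hlex hN⟩) hNU
  let e' := (ObjectProperty.ι _).mapIso e
  have he (s) : Function.Bijective (e'.hom.app s) :=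
    (isIso_iff_bijective _).1 inferInstance
  refine ⟨N', ObjectProperty.homMk (e'.hom ≫ N.ι), fun s => ?_, fun s x hx => ?_⟩
  · exact Subtype.val_injective.comp (he s).1
  · obtain ⟨y, hy⟩ := (he s).2 ⟨x, hTN s hx⟩
    exact ⟨y, congrArg Subtype.val hy⟩

lemma exists_subsetModel_factor (hgeo : 𝒮.IsGeometric) (hlex : 𝒮.IsLex) (hU : 𝒮.IsLarge U)
    (M : 𝒮.Mod) {F : Type} [Finite F] (B : F → 𝒮.Mod)
    (hB : ∀ a, 𝒮.boundedModels U (B a)) (f : ∀ a, B a ⟶ M) :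
    ∃ (N : 𝒮.SubsetModel U) (h : N.toMod ⟶ M), (∀ s, Function.Injective (h.hom.app s)) ∧
      ∀ a, ∃ g : B a ⟶ N.toMod, g ≫ h = f a := by
  have := hU.infinite
  obtain ⟨N, h, hinj, hT⟩ := exists_subsetModel_range hgeo hlex hU M
    (fun s => Set.range fun p : Σ a : ULift.{w} F, (B a.down).obj.obj s =>
      (f p.1.down).hom.app s p.2) fun s => Cardinal.mk_range_le.trans
        (Cardinal.mk_sigma_le_of_le (Cardinal.aleph0_le_mk U)
          (Cardinal.mk_le_aleph0.trans (Cardinal.aleph0_le_mk U)) fun a => hB a.down s)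
  refine ⟨N, h, hinj, fun a => ?_⟩
  obtain ⟨g, hg⟩ := NatTrans.exists_factor_of_injective h.hom hinj (f a).hom fun s => by
    rintro _ ⟨x, rfl⟩
    exact hT s ⟨⟨⟨a⟩, x⟩, rfl⟩
  exact ⟨ObjectProperty.homMk g, by ext : 1; exact hg⟩

lemma isAbsorbing_subsetModel (hgeo : 𝒮.IsGeometric) (hlex : 𝒮.IsLex) (hU : 𝒮.IsLarge U)
    :
    IsAbsorbing (SubsetModel.toMod (𝒮 := 𝒮) (U := U)) (𝒮.boundedModels U) where
  mem N := N.boundedModels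
  exists_mono M F _ B hB f := by
    obtain ⟨N, h, hinj, hf⟩ := exists_subsetModel_factor hgeo hlex hU M B hB f
    exact ⟨N, h, mono_of_injective hinj, hf⟩

/-- Each element of a model lies in a small submodel, and elements of small submodels that agree in
a model agree in a small submodel. -/
lemma isDetermined_evaluation (hgeo : 𝒮.IsGeometric) (hlex : 𝒮.IsLex) (hU : 𝒮.IsLarge U)
    (s : 𝒮.S) :
    IsDetermined (SubsetModel.toMod (𝒮 := 𝒮) (U := U)) (𝒮.evaluation.obj s) := by
  intro M
  have hN := isAbsorbing_subsetModel hgeo hlex hU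
  have := hN.isFiltered M
  have := hU.infinite
  refine ⟨Types.FilteredColimit.isColimitOf' _ _ (fun x => ?_) fun B x y h => ?_⟩
  · obtain ⟨N, h, hinj, hT⟩ := exists_subsetModel_range hgeo hlex hU M
      (fun t => {y | ∃ e : s = t, M.obj.map (eqToHom e) x = y}) fun t =>
        (Cardinal.mk_le_one_iff_set_subsingleton.2 (by
          rintro y ⟨_, rfl⟩ z ⟨_, rfl⟩
          rfl)).trans (Cardinal.one_le_aleph0.trans (Cardinal.aleph0_le_mk U))
    obtain ⟨y, hy⟩ := hT s (show x ∈ _ from ⟨rfl, ConcreteCategory.congr_hom (M.obj.map_id s) x⟩)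
    exact ⟨⟨N, h, mono_of_injective hinj⟩, y, hy.symm⟩
  · obtain ⟨N, k, hinj, hf⟩ := exists_subsetModel_factor hgeo hlex hU M (F := Unit)
      (fun _ => B.index.toMod) (fun _ => B.index.boundedModels) (fun _ => B.hom)
    obtain ⟨g, hg⟩ := hf ()
    refine ⟨⟨N, k, mono_of_injective hinj⟩, ⟨g, hg⟩, hinj s ?_⟩
    have hg' (z) : k.hom.app s (g.hom.app s z) = B.hom.hom.app s z :=
      ConcreteCategory.congr_hom (NatTrans.congr_app (congrArg (fun k => k.hom) hg) s) z
    exact (hg' x).trans (Eq.trans h (hg' y).symm)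

end

lemma exists_isLarge (𝒮 : Sketch.{w}) {K : Type w} (A : K → 𝒮.Mod) :
    ∃ U : Type w, 𝒮.IsLarge U ∧ ∀ k, 𝒮.boundedModels U (A k) := by
  refine ⟨ULift ℕ ⊕ (Σ a b : 𝒮.S, a ⟶ b) ⊕ (Σ k s, (A k).obj.obj s), ⟨inferInstance, ?_⟩,
    fun k s => ?_⟩
  · exact Cardinal.mk_le_of_injective (Sum.inr_injective.comp Sum.inl_injective)
  · exact Cardinal.mk_le_of_injective (f := fun x => Sum.inr (Sum.inr ⟨k, s, x⟩))
      fun x y h => by simpa using h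

theorem hasAbsorbingFamilies (hgeo : 𝒮.IsGeometric) (hlex : 𝒮.IsLex) :
    HasAbsorbingFamilies 𝒮.Mod := fun _ A => by
  obtain ⟨U, hU, hA⟩ := 𝒮.exists_isLarge A
  exact ⟨_, _, _, isAbsorbing_subsetModel hgeo hlex hU, hA⟩

theorem isSmallCopresheaf_evaluation (hgeo : 𝒮.IsGeometric) (hlex : 𝒮.IsLex) (s : 𝒮.S) :
    IsSmallCopresheaf (𝒮.evaluation.obj s) := by
  obtain ⟨U, hU, -⟩ := 𝒮.exists_isLarge (K := PEmpty) fun k => k.elim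
  exact (isDetermined_evaluation hgeo hlex hU s).isSmallCopresheaf
    (isAbsorbing_subsetModel hgeo hlex hU)

end Sketch

/-! ### Limits and colimits of small copresheaves -/

namespace HasAbsorbingFamilies

variable {X : Type u} [Category.{v} X]

theorem hasFiniteLimits (hX : HasAbsorbingFamilies X) : HasFiniteLimits (SmallCopresheaf X) where
  out J _ _ := by
    have := hX.isClosedUnderLimitsOfShape J
    infer_instance

theorem hasColimits (hX : HasAbsorbingFamilies X) :
    HasColimitsOfSize.{v, v} (SmallCopresheaf X) where
  has_colimits_of_shape J _ := by
    have := hX.isClosedUnderColimitsOfShape J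
    infer_instance

theorem preservesColimits_ι (hX : HasAbsorbingFamilies X) :
    PreservesColimitsOfSize.{v, v} (IsSmallCopresheaf (X := X)).ι where
  preservesColimitsOfShape {J} _ := by
    have := hX.isClosedUnderColimitsOfShape J
    infer_instance

end HasAbsorbingFamilies

/-! ### Extensions along the Yoneda embedding -/

section Yoneda

variable {C : Type w} [SmallCategory C] {E : Type u} [Category.{v} E]

/-- By the density theorem, a functor that preserves colimits is the pointwise left Kan extension of
its restriction to the representable presheaves. -/
lemma isPointwiseLan_of_preservesColimits {A : C ⥤ E} (L : (Cᵒᵖ ⥤ Type w) ⥤ E)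
    [PreservesColimitsOfSize.{w, w} L] (α : A ≅ yoneda ⋙ L) : IsPointwiseLan L α.hom := by
  refine ⟨fun P => ?_⟩
  let e : CostructuredArrow.proj yoneda P ⋙ A ≅ (CostructuredArrow.proj yoneda P ⋙ yoneda) ⋙ L :=
    Functor.isoWhiskerLeft (CostructuredArrow.proj yoneda P) α
  exact IsColimit.ofIsoColimit ((IsColimit.precomposeHomEquiv e _).symm
    (isColimitOfPreserves L (Presheaf.isColimitTautologicalCocone P)))
    (Cocone.ext (Iso.refl _) fun j => Category.comp_id _)

/-- Two functors that preserve colimits are isomorphic if their restrictions to the representable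
presheaves are. -/
lemma nonempty_iso_of_preservesColimits (L L' : (Cᵒᵖ ⥤ Type w) ⥤ E)
    [PreservesColimitsOfSize.{w, w} L] [PreservesColimitsOfSize.{w, w} L']
    (e : yoneda ⋙ L ≅ yoneda ⋙ L') : Nonempty (L ≅ L') := by
  obtain ⟨h⟩ := isPointwiseLan_of_preservesColimits L (Iso.refl _)
  obtain ⟨h'⟩ := isPointwiseLan_of_preservesColimits L' e
  have : L.IsLeftKanExtension (Iso.refl (yoneda ⋙ L)).hom := h.isLeftKanExtension
  have : L'.IsLeftKanExtension e.hom := h'.isLeftKanExtension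
  exact ⟨Functor.leftKanExtensionUnique L (Iso.refl (yoneda ⋙ L)).hom L' e.hom⟩

/-- The extension is constructed for an equivalent category whose morphisms form types in the
universe of the presheaves. -/
lemma exists_isLeftAdjoint_extension [LocallySmall.{w} E] [HasColimitsOfSize.{w, w} E]
    (A : C ⥤ E) : ∃ L : (Cᵒᵖ ⥤ Type w) ⥤ E, L.IsLeftAdjoint ∧ Nonempty (A ≅ yoneda ⋙ L) := by
  let e := ShrinkHoms.equivalence.{w} E
  have : HasColimitsOfSize.{w, w} (ShrinkHoms.{u} E) :=
    Adjunction.has_colimits_of_equivalence e.inverse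
  let L' : (Cᵒᵖ ⥤ Type w) ⥤ ShrinkHoms.{u} E :=
    (uliftYoneda.{w} (C := C)).leftKanExtension (A ⋙ e.functor)
  let η : A ⋙ e.functor ⟶ uliftYoneda.{w} ⋙ L' :=
    (uliftYoneda.{w} (C := C)).leftKanExtensionUnit (A ⋙ e.functor)
  have : L'.IsLeftAdjoint := (Presheaf.uliftYonedaAdjunction.{w} L' η).isLeftAdjoint
  have : IsIso η := inferInstance
  refine ⟨L' ⋙ e.inverse, inferInstance, ⟨?_⟩⟩
  exact (Functor.rightUnitor A).symm ≪≫ Functor.isoWhiskerLeft A e.unitIso ≪≫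
    (Functor.associator _ _ _).symm ≪≫ Functor.isoWhiskerRight (asIso η) e.inverse ≪≫
    Functor.isoWhiskerRight (Functor.isoWhiskerRight uliftYonedaIsoYoneda L') e.inverse ≪≫
    Functor.associator _ _ _

/-- If `M` preserves finite limits, its category of elements is cofiltered, and the colimit of the
values of a presheaf over the opposite of this category is an extension of `M` that preserves both
colimits and finite limits. -/
lemma preservesFiniteLimits_of_preservesColimits [HasFiniteLimits C]
    (L : (Cᵒᵖ ⥤ Type w) ⥤ Type w) [PreservesColimitsOfSize.{w, w} L]
    [PreservesFiniteLimits (yoneda ⋙ L)] : PreservesFiniteLimits L := by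
  let M := yoneda ⋙ L
  have := M.isCofiltered_elements
  let T : (Cᵒᵖ ⥤ Type w) ⥤ Type w :=
    (Functor.whiskeringLeft _ _ _).obj (CategoryOfElements.π M).op ⋙ colim
  have : PreservesColimitsOfSize.{w, w} T := inferInstance
  have : PreservesFiniteLimits T := inferInstance
  have e : yoneda ⋙ T ≅ yoneda ⋙ L :=
    (Functor.isoWhiskerRight shrinkYonedaIsoYoneda.symm T) ≪≫
      Functor.Elements.shrinkYonedaCompWhiskeringLeftObjπCompColimIso M
  obtain ⟨i⟩ := nonempty_iso_of_preservesColimits T L e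
  exact preservesFiniteLimits_of_natIso i

end Yoneda

/-! ### The adjunction and its comonad -/

section Adjunction

variable {C : Type w} [SmallCategory C] {E : Type u} [Category.{v} E] {A : C ⥤ E}
  {L : (Cᵒᵖ ⥤ Type w) ⥤ E} {R : E ⥤ Cᵒᵖ ⥤ Type w} (adj : L ⊣ R) (α : A ≅ yoneda ⋙ L)

/-- The unit of the right adjoint of `L` as an extension of the Yoneda embedding along `A`: the
transpose of the isomorphism `yoneda ⋙ L ≅ A`. -/
def yonedaExtensionUnit : yoneda ⟶ A ⋙ R where
  app s := adj.unit.app (yoneda.obj s) ≫ R.map (α.inv.app s)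
  naturality s t f := by
    have h := adj.unit.naturality (yoneda.map f)
    have h' := α.inv.naturality f
    dsimp at h h' ⊢
    rw [reassoc_of% h, Category.assoc, ← R.map_comp, ← R.map_comp, h']

lemma yonedaExtensionUnit_app_map (s : C) :
    (yonedaExtensionUnit adj α).app s ≫ R.map (α.hom.app s) = adj.unit.app (yoneda.obj s) := by
  simp [yonedaExtensionUnit, ← R.map_comp]

/-- The bijection between arrows `A.obj s ⟶ P` and `yoneda.obj s ⟶ R.obj P`, in its explicit
form. -/
lemma yonedaExtensionUnit_app_comp_map {s : C} {P : E} (c : A.obj s ⟶ P) :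
    (yonedaExtensionUnit adj α).app s ≫ R.map c =
      adj.homEquiv (yoneda.obj s) P (α.inv.app s ≫ c) := by
  rw [adj.homEquiv_unit]
  simp [yonedaExtensionUnit]

/-- The functor taking arrows from the Yoneda embedding to `R.obj P` to arrows from `A` to `P`. -/
def costructuredArrowOfAdjunction (P : E) :
    CostructuredArrow yoneda (R.obj P) ⥤ CostructuredArrow A P where
  obj j := CostructuredArrow.mk
    (α.hom.app j.left ≫ (adj.homEquiv (yoneda.obj j.left) P).symm j.hom)
  map f := CostructuredArrow.homMk f.left (by
    have h := α.hom.naturality f.left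
    have h' := adj.homEquiv_naturality_left_symm (yoneda.map f.left) (CostructuredArrow.hom _)
    dsimp at h ⊢
    rw [reassoc_of% h, ← h', CostructuredArrow.w])

/-- The arrows from `A` to `P` correspond to the arrows from the Yoneda embedding to `R.obj P`,
whose colimit is `R.obj P` by the density theorem. -/
lemma isPointwiseLan_yonedaExtensionUnit : IsPointwiseLan R (yonedaExtensionUnit adj α) := by
  refine ⟨fun P => ?_⟩
  let T := Presheaf.isColimitTautologicalCocone (R.obj P)
  let Φ := costructuredArrowOfAdjunction adj α P
  have hΦ (j : CostructuredArrow yoneda (R.obj P)) :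
      (yonedaExtensionUnit adj α).app j.left ≫ R.map (Φ.obj j).hom = j.hom := by
    refine (yonedaExtensionUnit_app_comp_map adj α _).trans ?_
    simp [Φ, costructuredArrowOfAdjunction]
  have hΦ' (c : CostructuredArrow A P) : α.hom.app c.left ≫ (adj.homEquiv _ P).symm
      ((yonedaExtensionUnit adj α).app c.left ≫ R.map c.hom) = c.hom := by
    rw [yonedaExtensionUnit_app_comp_map]
    simp
  let t' (t : Cocone (CostructuredArrow.proj A P ⋙ yoneda)) :
      Cocone (CostructuredArrow.proj yoneda (R.obj P) ⋙ yoneda) :=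
    { pt := t.pt
      ι := { app := fun j => t.ι.app (Φ.obj j)
             naturality := fun _ _ f => t.ι.naturality (Φ.map f) } }
  exact
    { desc := fun t => T.desc (t' t)
      fac := fun t c => by
        refine (T.fac (t' t) (CostructuredArrow.mk (Y := c.left) _)).trans ?_
        have aux (x : A.obj c.left ⟶ P) (hx : x = c.hom) :
            t.ι.app (CostructuredArrow.mk (S := A) (Y := c.left) x) = t.ι.app c := by
          subst hx
          rfl
        exact aux _ (hΦ' c)
      uniq := fun t m hm => T.hom_ext fun j => by
        refine Eq.trans ?_ (T.fac (t' t) j).symm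
        refine Eq.trans ?_ (hm (Φ.obj j))
        exact congrArg (· ≫ m) (hΦ j).symm }

/-- The unit of `R ⋙ L` as an extension of `A` along itself. -/
def densityUnit : A ⟶ A ⋙ R ⋙ L where
  app s := α.hom.app s ≫ L.map ((yonedaExtensionUnit adj α).app s)
  naturality s t f := by
    have h := α.hom.naturality f
    have h' := (yonedaExtensionUnit adj α).naturality f
    dsimp at h h' ⊢
    rw [reassoc_of% h, Category.assoc, ← L.map_comp, ← L.map_comp, h']

/-- The functor `L`, being a left adjoint, preserves the pointwise Kan extension `R`. -/
lemma isDensityComonad_toComonad :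
    IsDensityComonad A adj.toComonad (densityUnit adj α) where
  isLan := by
    obtain ⟨h⟩ := isPointwiseLan_yonedaExtensionUnit adj α
    refine ⟨fun P => ?_⟩
    have := adj.leftAdjoint_preservesColimits
    let e : CostructuredArrow.proj A P ⋙ A ≅ (CostructuredArrow.proj A P ⋙ yoneda) ⋙ L :=
      Functor.isoWhiskerLeft (CostructuredArrow.proj A P) α
    exact IsColimit.ofIsoColimit ((IsColimit.precomposeHomEquiv e _).symm
      (isColimitOfPreserves L (h P)))
      (Cocone.ext (Iso.refl _) fun j => by
        refine (Category.comp_id _).trans ?_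
        change α.hom.app j.left ≫ L.map ((yonedaExtensionUnit adj α).app j.left ≫ R.map j.hom) =
          (α.hom.app j.left ≫ L.map ((yonedaExtensionUnit adj α).app j.left)) ≫
            L.map (R.map j.hom)
        rw [L.map_comp, Category.assoc])
  counit s := by
    change (α.hom.app s ≫ L.map (adj.unit.app _ ≫ R.map (α.inv.app s))) ≫ adj.counit.app _ = _
    have h := adj.counit.naturality (α.inv.app s)
    have h' := adj.left_triangle_components_assoc (yoneda.obj s) (α.inv.app s)
    dsimp only [Functor.comp_obj, Functor.comp_map, Functor.id_obj, Functor.id_map] at h h'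
    simp only [L.map_comp, Category.assoc, h]
    exact (congrArg _ h').trans (α.hom_inv_id_app s)
  comul s := by
    change (α.hom.app s ≫ L.map ((yonedaExtensionUnit adj α).app s)) ≫ L.map (adj.unit.app _) =
      (α.hom.app s ≫ L.map ((yonedaExtensionUnit adj α).app s)) ≫
        L.map (R.map (α.hom.app s ≫ L.map ((yonedaExtensionUnit adj α).app s)))
    have h := adj.unit.naturality ((yonedaExtensionUnit adj α).app s)
    dsimp at h
    simp only [Category.assoc, ← L.map_comp, R.map_comp,
      reassoc_of% yonedaExtensionUnit_app_map adj α]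
    rw [h]

end Adjunction

namespace Sketch

variable {𝒮 : Sketch.{w}}

lemma preservesFiniteLimits_evaluation (hlex : 𝒮.IsLex) : PreservesFiniteLimits 𝒮.evaluation :=
  preservesFiniteLimits_of_evaluation _ fun M => M.property.preservesFiniteLimits hlex

lemma preservesFiniteLimits_ev (hlex : 𝒮.IsLex)
    (h : ∀ s, IsSmallCopresheaf (𝒮.evaluation.obj s)) : PreservesFiniteLimits (𝒮.ev h) := by
  have : PreservesFiniteLimits (𝒮.ev h ⋙ IsSmallCopresheaf.ι) :=
    preservesFiniteLimits_evaluation hlex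
  exact ⟨fun J _ _ => preservesLimitsOfShape_of_reflects_of_preserves _ IsSmallCopresheaf.ι⟩

/-- Preservation of finite limits is tested at each model `M`, where the extension becomes that of
the functor `M`. -/
lemma preservesFiniteLimits_extension (hlex : 𝒮.IsLex) (hX : HasAbsorbingFamilies 𝒮.Mod)
    (h : ∀ s, IsSmallCopresheaf (𝒮.evaluation.obj s))
    (L : (𝒮.Sᵒᵖ ⥤ Type w) ⥤ SmallCopresheaf 𝒮.Mod) [PreservesColimitsOfSize.{w, w} L]
    (α : 𝒮.ev h ≅ yoneda ⋙ L) : PreservesFiniteLimits L := by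
  have := hX.preservesColimits_ι
  have := hlex.hasFiniteLimits
  have : PreservesFiniteLimits (L ⋙ IsSmallCopresheaf.ι) :=
    preservesFiniteLimits_of_evaluation _ fun M => by
      let T := (L ⋙ IsSmallCopresheaf.ι) ⋙ (CategoryTheory.evaluation 𝒮.Mod (Type w)).obj M
      have e : M.obj ≅ yoneda ⋙ T :=
        Functor.isoWhiskerRight α
          (IsSmallCopresheaf.ι ⋙ (CategoryTheory.evaluation 𝒮.Mod (Type w)).obj M)
      have := M.property.preservesFiniteLimits hlex
      have : PreservesFiniteLimits (yoneda ⋙ T) := preservesFiniteLimits_of_natIso e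
      exact preservesFiniteLimits_of_preservesColimits T
  exact ⟨fun J _ _ => preservesLimitsOfShape_of_reflects_of_preserves _ IsSmallCopresheaf.ι⟩

end Sketch

theorem mainTheorem5 (𝒮 : Sketch.{w}) (hgeo : 𝒮.IsGeometric) (hlex : 𝒮.IsLex) :
    ∃ (hev : ∀ s : 𝒮.S, IsSmallCopresheaf (𝒮.evaluation.obj s))
      (𝕄od : GeneralizedIonad 𝒮.Mod)
      (L : (𝒮.Sᵒᵖ ⥤ Type w) ⥤ SmallCopresheaf 𝒮.Mod)
      (R : SmallCopresheaf 𝒮.Mod ⥤ (𝒮.Sᵒᵖ ⥤ Type w))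
      (adj : L ⊣ R)
      (α : 𝒮.ev hev ⟶ yoneda ⋙ L)
      (β : yoneda ⟶ 𝒮.ev hev ⋙ R)
      (θ : 𝒮.ev hev ⟶ 𝒮.ev hev ⋙ 𝕄od.interior.toFunctor),
      HasFiniteLimits (SmallCopresheaf 𝒮.Mod) ∧
      PreservesFiniteLimits (𝒮.ev hev) ∧
      IsPointwiseLan L α ∧
      PreservesFiniteLimits L ∧
      IsPointwiseLan R β ∧
      (∀ s : 𝒮.S, β.app s ≫ R.map (α.app s) = adj.unit.app (yoneda.obj s)) ∧
      𝕄od.interior = adj.toComonad ∧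
      IsDensityComonad (𝒮.ev hev) 𝕄od.interior θ := by
  have hX := Sketch.hasAbsorbingFamilies hgeo hlex
  have hev := Sketch.isSmallCopresheaf_evaluation hgeo hlex
  have := hX.hasColimits
  obtain ⟨L, _, ⟨α⟩⟩ := exists_isLeftAdjoint_extension (𝒮.ev hev)
  let adj := Adjunction.ofIsLeftAdjoint L
  have := adj.leftAdjoint_preservesColimits
  have := adj.rightAdjoint_preservesLimits
  have hL : PreservesFiniteLimits L := Sketch.preservesFiniteLimits_extension hlex hX hev L α
  let 𝕄od : GeneralizedIonad 𝒮.Mod :=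
    { preFinitelyCocomplete := hX.preFinitelyCocomplete
      interior := adj.toComonad
      interior_lex := by
        have : PreservesFiniteLimits L.rightAdjoint := inferInstance
        exact comp_preservesFiniteLimits L.rightAdjoint L }
  exact ⟨hev, 𝕄od, L, L.rightAdjoint, adj, α.hom, yonedaExtensionUnit adj α, densityUnit adj α,
    hX.hasFiniteLimits, Sketch.preservesFiniteLimits_ev hlex hev,
    isPointwiseLan_of_preservesColimits L α, hL, isPointwiseLan_yonedaExtensionUnit adj α,
    yonedaExtensionUnit_app_map adj α, rfl, isDensityComonad_toComonad adj α⟩
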